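/- Let $(\mathcal V,\otimes,I)$ be a cocomplete closed monoidal category, where closed means that for every object $X$ of $\mathcal V$ both functors $X\otimes -$ and $-\otimes X$ have right adjoints (for example, any cocomplete symmetric monoidal closed category). Let $\mathcal V\text{-}\mathbf{Cat}$ be the category of small $\mathcal V$-categories and $\mathcal V$-functors. Call a $\mathcal V$-functor $F:\mathcal X\to\mathcal Y$ a full and faithful inclusion if it is injective on objects and all the morphisms $\mathcal X(x,y)\to\mathcal Y(Fx,Fy)$ are isomorphisms in $\mathcal V$. Let $\mathcal A$, $\mathcal B$, $\mathcal C$ be small $\mathcal V$-categories, let $i:\mathcal A\hookrightarrow\mathcal B$ be a full and faithful inclusion and let $f:\mathcal A\to\mathcal C$ be any $\mathcal V$-functor. Then the pushout of $i$ and $f$ exists in $\mathcal V\text{-}\mathbf{Cat}$, and in every pushout square in $\mathcal V\text{-}\mathbf{Cat}$ $$\begin{array}{ccc}\mathcal A&\xrightarrow{\;i\;}&\mathcal B\\ {\scriptstyle f}\downarrow&&\downarrow{\scriptstyle g}\\ \mathcal C&\xrightarrow{\;i'\;}&\mathcal D\end{array}$$ the $\mathcal V$-functor $i':\mathcal C\to\mathcal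 D$ is a full and faithful inclusion. -/

import Mathlib

universe w v

namespace CategoryTheory

open MonoidalCategory Limits

namespace EnrichedFunctor

universe u₁ u₂

variable {V : Type v} [Category.{w} V] [MonoidalCategory V]
variable {A : Type u₁} [EnrichedCategory V A] {B : Type u₂} [EnrichedCategory V B]

/-- A `V`-functor is full and faithful if it is locally an isomorphism, that is, if all its
action morphisms `A(x, y) ⟶ B(F x, F y)` are isomorphisms in `V`. -/
def FullAndFaithful (F : EnrichedFunctor V A B) : Prop :=
  ∀ x y : A, IsIso (F.map x y)

/-- A full and faithful inclusion of `V`-categories: a full and faithful `V`-functor that is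
injective on objects. -/
structure IsFullAndFaithfulInclusion (F : EnrichedFunctor V A B) : Prop where
  fullAndFaithful : F.FullAndFaithful
  injective_obj : Function.Injective F.obj

end EnrichedFunctor

/-- The 1-category `V-Cat`: objects are `V`-categories, morphisms are `V`-functors with their
usual identities and composition, and two `V`-functors are identified only if they are equal
(not merely isomorphic). -/
instance EnrichedCat.category (V : Type v) [Category.{w} V] [MonoidalCategory V] :
    Category (EnrichedCat.{w, v, w} V) where
  Hom A B := EnrichedFunctor V A B
  id A := EnrichedFunctor.id V A
  comp F G := EnrichedFunctor.comp V F G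
  id_comp F := by
    cases F
    simp [EnrichedFunctor.comp, EnrichedFunctor.id]
  comp_id F := by
    cases F
    simp [EnrichedFunctor.comp, EnrichedFunctor.id]
  assoc F G H := by
    simp [EnrichedFunctor.comp]

end CategoryTheory

open CategoryTheory MonoidalCategory Limits

/-!
A right module over a `V`-category `X` is a `V`-functor `X ⥤ V`. If the pushout `D` existed, a
module over `D` would be a pair of modules over `C` and `B` with the same restriction to `A`. Such
*glued modules* make sense without `D`, and `D` is recovered as their category of representables:
evaluation of glued modules at each object of the prospective `D` is representable, the representing
modules give the morphism objects, and their universal properties give composition and the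
universal property of `D`.

To represent evaluation at `c`, take the `C`-module `C(c, -)` together with the left Kan extension
to `B` of its restriction to `A`. For `b` in `B` outside of `A`, take the left Kan extension to `C`
of the restriction of `B(b, -)` to `A`, and correct `B(b, -)` by a pushout of modules over `B`. As
`i` is full and faithful, the unit of the extension along `i` is invertible, so that the two
modules do agree on `A` while the `C`-module remains unchanged. In particular `D(c, c') = C(c, c')`.
-/

noncomputable section

namespace EnrichedPushout

universe u₁ u₂

variable {V : Type v} [Category.{w} V] [MonoidalCategory V]

lemma eId_whiskerRight_eComp {B : Type u₁} [EnrichedCategory V B] (x y : B) :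
    eId V x ▷ (x ⟶[V] y) ≫ eComp V x x y = (λ_ _).hom := by
  rw [← cancel_epi (λ_ _).inv, e_id_comp, Iso.inv_hom_id]

lemma whiskerLeft_eId_eComp {B : Type u₁} [EnrichedCategory V B] (x y : B) :
    (x ⟶[V] y) ◁ eId V y ≫ eComp V x y y = (ρ_ _).hom := by
  rw [← cancel_epi (ρ_ _).inv, e_comp_id, Iso.inv_hom_id]

section RightCurry

variable [∀ X : V, (tensorRight X).IsLeftAdjoint]

/-- Currying in the variable on the right, for the right adjoint of `- ⊗ L`. -/
def rightCurry {Y L X : V} : (Y ⊗ L ⟶ X) ≃ (Y ⟶ (tensorRight L).rightAdjoint.obj X) :=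
  (Adjunction.ofIsLeftAdjoint (tensorRight L)).homEquiv Y X

lemma rightCurry_whiskerRight_comp {Y Y' L X : V} (f : Y ⟶ Y') (g : Y' ⊗ L ⟶ X) :
    rightCurry (f ▷ L ≫ g) = f ≫ rightCurry g :=
  Adjunction.homEquiv_naturality_left _ _ _

lemma initial_tensor_hom_ext [HasInitial V] {L X : V} (f g : (⊥_ V) ⊗ L ⟶ X) : f = g :=
  rightCurry.injective (initialIsInitial.hom_ext _ _)

end RightCurry

/-! ### Modules over a `V`-category -/

/-- A right module structure over a `V`-category `B` on a family of objects of `V`. When `V` is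
closed this is the same as a `V`-functor `B ⥤ V` with the given values, in uncurried form. -/
@[ext]
structure RightAction (B : Type u₁) [EnrichedCategory V B] (M : B → V) where
  act : ∀ x y, M x ⊗ (x ⟶[V] y) ⟶ M y
  act_id : ∀ x, M x ◁ eId V x ≫ act x x = (ρ_ (M x)).hom
  act_comp : ∀ x y z, act x y ▷ (y ⟶[V] z) ≫ act y z =
    (α_ (M x) (x ⟶[V] y) (y ⟶[V] z)).hom ≫ M x ◁ eComp V x y z ≫ act x z

namespace RightAction

variable {A : Type u₂} [EnrichedCategory V A] {B : Type u₁} [EnrichedCategory V B]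
  {M N P : B → V}

/-- Restriction of a module along a `V`-functor. -/
@[simps]
def restrict (β : RightAction B M) (F : EnrichedFunctor V A B) :
    RightAction A (fun a => M (F.obj a)) where
  act x y := M (F.obj x) ◁ F.map x y ≫ β.act (F.obj x) (F.obj y)
  act_id x := by
    rw [← whiskerLeft_comp_assoc, F.map_id, β.act_id]
  act_comp x y z := by
    rw [comp_whiskerRight, Category.assoc, ← whisker_exchange_assoc, β.act_comp,
      ← whiskerLeft_comp_assoc, F.map_comp]
    simp [MonoidalCategory.tensorHom_def]

/-- The module `B(b, -)` represented by an object `b`. -/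
@[simps]
def representable (b : B) : RightAction B (fun y => (b ⟶[V] y)) where
  act x y := eComp V b x y
  act_id x := whiskerLeft_eId_eComp b x
  act_comp x y z := (e_assoc' V b x y z).symm

/-- Transport of a module structure along a family of isomorphisms. -/
@[simps]
def transport (β : RightAction B M) (e : ∀ x, M x ≅ N x) : RightAction B N where
  act x y := (e x).inv ▷ _ ≫ β.act x y ≫ (e y).hom
  act_id x := by
    rw [whisker_exchange_assoc, reassoc_of% β.act_id]
    simp
  act_comp x y z := by
    simp only [comp_whiskerRight, Category.assoc, hom_inv_whiskerRight_assoc]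
    rw [reassoc_of% β.act_comp, associator_naturality_left_assoc, whisker_exchange_assoc]

/-- The tensor `K ⊗ M` of a module with an object of `V`. -/
@[simps]
def tensor (K : V) (β : RightAction B M) : RightAction B (fun x => K ⊗ M x) where
  act x y := (α_ K (M x) _).hom ≫ K ◁ β.act x y
  act_id x := by
    rw [associator_naturality_right_assoc, ← whiskerLeft_comp, β.act_id]
    simp
  act_comp x y z := by
    simp only [comp_whiskerRight, Category.assoc, associator_naturality_middle_assoc]
    rw [← whiskerLeft_comp, β.act_comp]
    simp

lemma restrict_tensor (K : V) (β : RightAction B M) (F : EnrichedFunctor V A B) :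
    (β.tensor K).restrict F = (β.restrict F).tensor K := by
  ext x y
  simp

/-- The initial module. -/
def initial (B : Type u₁) [EnrichedCategory V B] [HasInitial V]
    [∀ X : V, (tensorRight X).IsLeftAdjoint] : RightAction B (fun _ => ⊥_ V) where
  act _ _ := rightCurry.symm (initial.to _)
  act_id _ := initial_tensor_hom_ext _ _
  act_comp _ _ _ := by
    rw [← cancel_epi (α_ _ _ _).inv]
    exact initial_tensor_hom_ext _ _

/-- Linearity of a family of morphisms between the underlying families of two modules. -/
def IsLinear (α : RightAction B M) (β : RightAction B N) (φ : ∀ x, M x ⟶ N x) : Prop :=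
  ∀ x y, φ x ▷ (x ⟶[V] y) ≫ β.act x y = α.act x y ≫ φ y

variable {α : RightAction B M} {β : RightAction B N} {γ : RightAction B P}

lemma IsLinear.id (α : RightAction B M) : IsLinear α α (fun _ => 𝟙 _) := by
  intro x y
  simp

lemma IsLinear.comp {φ : ∀ x, M x ⟶ N x} {ψ : ∀ x, N x ⟶ P x}
    (hφ : IsLinear α β φ) (hψ : IsLinear β γ ψ) : IsLinear α γ (fun x => φ x ≫ ψ x) := by
  intro x y
  rw [comp_whiskerRight, Category.assoc, hψ, ← Category.assoc, hφ, Category.assoc]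

lemma IsLinear.restrict {φ : ∀ x, M x ⟶ N x} (hφ : IsLinear α β φ)
    (F : EnrichedFunctor V A B) :
    IsLinear (α.restrict F) (β.restrict F) (fun a => φ (F.obj a)) := by
  intro x y
  simp only [restrict_act, Category.assoc]
  rw [← hφ, whisker_exchange_assoc]

lemma isLinear_transport_hom (e : ∀ x, M x ≅ N x) :
    IsLinear α (α.transport e) (fun x => (e x).hom) := by
  intro x y
  simp

lemma isLinear_transport_inv (e : ∀ x, M x ≅ N x) :
    IsLinear (α.transport e) α (fun x => (e x).inv) := by
  intro x y
  simp

lemma IsLinear.whiskerLeft (K : V) {φ : ∀ x, M x ⟶ N x} (hφ : IsLinear α β φ) :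
    IsLinear (α.tensor K) (β.tensor K) (fun x => K ◁ φ x) := by
  intro x y
  rw [tensor_act, tensor_act, associator_naturality_middle_assoc, ← whiskerLeft_comp, hφ,
    whiskerLeft_comp, Category.assoc]

lemma isLinear_whiskerRight {K L : V} (k : K ⟶ L) (α : RightAction B M) :
    IsLinear (α.tensor K) (α.tensor L) (fun x => k ▷ M x) := by
  intro x y
  rw [tensor_act, tensor_act, associator_naturality_left_assoc, ← whisker_exchange,
    Category.assoc]

lemma isLinear_associator (K L : V) (α : RightAction B M) :
    IsLinear (α.tensor (K ⊗ L)) ((α.tensor L).tensor K) (fun x => (α_ K L (M x)).hom) := by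
  intro x y
  simp

lemma isLinear_leftUnitor_inv (α : RightAction B M) :
    IsLinear α (α.tensor (𝟙_ V)) (fun x => (λ_ (M x)).inv) := by
  intro x y
  simp

/-- The linear map out of a representable module which corresponds to an element under the Yoneda
lemma. -/
def yonedaHom (β : RightAction B N) {b : B} (e : 𝟙_ V ⟶ N b) (y : B) : (b ⟶[V] y) ⟶ N y :=
  (λ_ _).inv ≫ e ▷ _ ≫ β.act b y

lemma isLinear_yonedaHom (β : RightAction B N) {b : B} (e : 𝟙_ V ⟶ N b) :
    IsLinear (representable b) β (β.yonedaHom e) := by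
  intro x y
  simp only [yonedaHom, comp_whiskerRight, Category.assoc, representable_act]
  rw [β.act_comp, associator_naturality_left_assoc, ← whisker_exchange_assoc]
  simp

lemma eId_yonedaHom (β : RightAction B N) {b : B} (e : 𝟙_ V ⟶ N b) :
    eId V b ≫ β.yonedaHom e b = e := by
  rw [yonedaHom, leftUnitor_inv_naturality_assoc, whisker_exchange_assoc, β.act_id,
    rightUnitor_naturality]
  simp [unitors_inv_equal]

lemma IsLinear.eq_yonedaHom {b : B} {φ : ∀ y, (b ⟶[V] y) ⟶ N y}
    (hφ : IsLinear (representable b) β φ) (y : B) : φ y = β.yonedaHom (eId V b ≫ φ b) y := by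
  rw [yonedaHom, comp_whiskerRight_assoc, hφ, representable_act, e_id_comp_assoc]

lemma IsLinear.representable_ext {b : B} {φ ψ : ∀ y, (b ⟶[V] y) ⟶ N y}
    (hφ : IsLinear (representable b) β φ) (hψ : IsLinear (representable b) β ψ)
    (h : eId V b ≫ φ b = eId V b ≫ ψ b) (y : B) : φ y = ψ y := by
  rw [hφ.eq_yonedaHom, hψ.eq_yonedaHom, h]

lemma IsLinear.yonedaHom_comp {b : B} {φ : ∀ x, N x ⟶ P x} (hφ : IsLinear β γ φ)
    (e : 𝟙_ V ⟶ N b) (y : B) :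
    β.yonedaHom e y ≫ φ y = γ.yonedaHom (e ≫ φ b) y := by
  simp only [yonedaHom, comp_whiskerRight, Category.assoc]
  rw [hφ b y]

lemma map_comp_yonedaHom (β : RightAction B N) (F : EnrichedFunctor V A B) {a : A}
    (e : 𝟙_ V ⟶ N (F.obj a)) (a' : A) :
    F.map a a' ≫ β.yonedaHom e (F.obj a') = (β.restrict F).yonedaHom e a' := by
  rw [yonedaHom, yonedaHom, restrict_act, leftUnitor_inv_naturality_assoc,
    whisker_exchange_assoc]

lemma yonedaHom_representable_eId (b y : B) :
    (representable b).yonedaHom (eId V b) y = 𝟙 (b ⟶[V] y) :=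
  e_id_comp V b y

lemma yonedaHom_restrict_representable_eId (F : EnrichedFunctor V A B) (a a' : A) :
    ((representable (F.obj a)).restrict F).yonedaHom (eId V (F.obj a)) a' = F.map a a' := by
  rw [← map_comp_yonedaHom, yonedaHom_representable_eId, Category.comp_id]

lemma IsLinear.whiskerLeft_yonedaHom_comp {b : B} {φ : ∀ y, N b ⊗ M y ⟶ N y}
    (hφ : IsLinear (α.tensor (N b)) β φ) {u : 𝟙_ V ⟶ M b} (hu : N b ◁ u ≫ φ b = (ρ_ _).hom)
    (y : B) : N b ◁ α.yonedaHom u y ≫ φ y = β.act b y := by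
  have hφ' := hφ b y
  rw [tensor_act, Category.assoc, ← Iso.inv_comp_eq] at hφ'
  rw [yonedaHom, whiskerLeft_comp_assoc, whiskerLeft_comp_assoc, ← hφ',
    associator_inv_naturality_middle_assoc, ← comp_whiskerRight_assoc, hu]
  simp

lemma isLinear_eComp (b b' : B) :
    IsLinear ((representable b').tensor (b ⟶[V] b')) (representable b) (eComp V b b') := by
  intro x y
  simp [e_assoc']

section Closed

variable [MonoidalClosed V]

/-- Evaluation for the closed structure, stated without the identity functor in its codomain. -/
def eval (K X : V) : K ⊗ (CategoryTheory.ihom K).obj X ⟶ X :=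
  (CategoryTheory.ihom.ev K).app X

lemma whiskerLeft_curry_eval {K X Y : V} (φ : K ⊗ Y ⟶ X) :
    K ◁ MonoidalClosed.curry φ ≫ eval K X = φ :=
  (MonoidalClosed.uncurry_eq _).symm.trans (MonoidalClosed.uncurry_curry φ)

lemma ihom_hom_ext {K X Y : V} {φ ψ : Y ⟶ (CategoryTheory.ihom K).obj X}
    (h : K ◁ φ ≫ eval K X = K ◁ ψ ≫ eval K X) : φ = ψ :=
  MonoidalClosed.uncurry_injective h

/-- The cotensor of a module with an object of `V`. -/
@[simps]
def ihom (K : V) (β : RightAction B N) :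
    RightAction B (fun x => (CategoryTheory.ihom K).obj (N x)) where
  act x y := MonoidalClosed.curry
    ((α_ K _ _).inv ≫ eval K (N x) ▷ _ ≫ β.act x y)
  act_id x := by
    apply ihom_hom_ext
    rw [whiskerLeft_comp_assoc, whiskerLeft_curry_eval, associator_inv_naturality_right_assoc,
      whisker_exchange_assoc, β.act_id, rightUnitor_naturality]
    simp
  act_comp x y z := by
    apply ihom_hom_ext
    simp only [whiskerLeft_comp, Category.assoc, whiskerLeft_curry_eval]
    rw [associator_inv_naturality_middle_assoc, ← comp_whiskerRight_assoc,
      whiskerLeft_curry_eval, associator_inv_naturality_right_assoc, whisker_exchange_assoc]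
    simp only [comp_whiskerRight, Category.assoc, β.act_comp, associator_naturality_left_assoc]
    simp

lemma restrict_ihom (K : V) (β : RightAction B N) (F : EnrichedFunctor V A B) :
    (β.ihom K).restrict F = (β.restrict F).ihom K := by
  ext x y
  apply ihom_hom_ext
  rw [restrict_act, ihom_act, ihom_act, restrict_act, whiskerLeft_comp_assoc,
    whiskerLeft_curry_eval, whiskerLeft_curry_eval, associator_inv_naturality_right_assoc,
    whisker_exchange_assoc]

lemma isLinear_curry_iff {K : V} {φ : ∀ x, K ⊗ M x ⟶ N x} :
    IsLinear α (β.ihom K) (fun x => MonoidalClosed.curry (φ x)) ↔ IsLinear (α.tensor K) β φ := by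
  refine forall₂_congr fun x y => ?_
  have curry_act : MonoidalClosed.curry (φ x) ▷ _ ≫ (β.ihom K).act x y =
      MonoidalClosed.curry ((α_ K (M x) _).inv ≫ φ x ▷ _ ≫ β.act x y) := by
    apply ihom_hom_ext
    rw [whiskerLeft_comp_assoc, ihom_act, whiskerLeft_curry_eval, whiskerLeft_curry_eval,
      associator_inv_naturality_middle_assoc, ← comp_whiskerRight_assoc, whiskerLeft_curry_eval]
  rw [curry_act, ← MonoidalClosed.curry_natural_left, MonoidalClosed.curry_injective.eq_iff,
    Iso.inv_comp_eq, tensor_act, Category.assoc]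

end Closed

end RightAction

/-! ### Extension of modules along a `V`-functor -/

section Extension

variable {A : Type w} [EnrichedCategory V A] {B : Type u₁} [EnrichedCategory V B]

/-- A `B`-module `N` together with a linear map from its restriction along `F` to an
`A`-module `P`. -/
structure ModuleSpan (F : EnrichedFunctor V A B) where
  N : B → V
  ν : RightAction B N
  P : A → V
  π : RightAction A P
  θ : ∀ a, N (F.obj a) ⟶ P a
  isLinear_θ : (ν.restrict F).IsLinear π θ

namespace ModuleSpan

variable {F : EnrichedFunctor V A B} (S : ModuleSpan F)

/-- The shape of the colimits computing `ModuleSpan.extension`: the objects are `N y` and, for `a`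
in `A`, the summands `P a ⊗ B(F a, y)` of the Kan extension of `P`. -/
def shape (A : Type w) : MultispanShape.{w, w} where
  L := (A × A) ⊕ A
  R := Option A
  fst := Sum.elim (fun p => some p.2) (fun _ => none)
  snd := Sum.elim (fun p => some p.1) (fun a => some a)

/-- The diagram whose colimit is the value of `ModuleSpan.extension` at `y`. -/
def index (y : B) : MultispanIndex (shape A) V where
  left := Sum.elim (fun p => (S.P p.1 ⊗ (p.1 ⟶[V] p.2)) ⊗ (F.obj p.2 ⟶[V] y))
    (fun a => S.N (F.obj a) ⊗ (F.obj a ⟶[V] y))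
  right := fun o => o.elim (S.N y) (fun a => S.P a ⊗ (F.obj a ⟶[V] y))
  fst := fun p => match p with
    | Sum.inl (a, a') => S.π.act a a' ▷ (F.obj a' ⟶[V] y)
    | Sum.inr a => S.ν.act (F.obj a) y
  snd := fun p => match p with
    | Sum.inl (a, a') => (α_ _ _ _).hom ≫
        S.P a ◁ (F.map a a' ▷ (F.obj a' ⟶[V] y) ≫ eComp V (F.obj a) (F.obj a') y)
    | Sum.inr a => S.θ a ▷ (F.obj a ⟶[V] y)

/-- Two families of morphisms form a cocone under the diagram defining the extension. -/
structure IsCocone (S : ModuleSpan F) {y : B} {X : V} (k : S.N y ⟶ X)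
    (l : ∀ a, S.P a ⊗ (F.obj a ⟶[V] y) ⟶ X) : Prop where
  act_comp : ∀ a a', S.π.act a a' ▷ (F.obj a' ⟶[V] y) ≫ l a' = (α_ _ _ _).hom ≫
    S.P a ◁ (F.map a a' ▷ (F.obj a' ⟶[V] y) ≫ eComp V (F.obj a) (F.obj a') y) ≫ l a
  act_eq : ∀ a, S.ν.act (F.obj a) y ≫ k = S.θ a ▷ (F.obj a ⟶[V] y) ≫ l a

variable {S} in
lemma isCocone_of_isLinear {R : B → V} {ρ : RightAction B R} {φ : ∀ y, S.N y ⟶ R y}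
    (hφ : S.ν.IsLinear ρ φ) {ψ : ∀ a, S.P a ⟶ R (F.obj a)} (hψ : S.π.IsLinear (ρ.restrict F) ψ)
    (h : ∀ a, S.θ a ≫ ψ a = φ (F.obj a)) (y : B) :
    S.IsCocone (φ y) (fun a => ψ a ▷ (F.obj a ⟶[V] y) ≫ ρ.act (F.obj a) y) where
  act_comp a a' := by
    rw [← comp_whiskerRight_assoc, ← hψ]
    simp only [RightAction.restrict_act, comp_whiskerRight, Category.assoc, ρ.act_comp]
    rw [associator_naturality_middle_assoc, associator_naturality_left_assoc,
      whiskerLeft_comp_assoc, whisker_exchange_assoc, whisker_exchange_assoc]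
  act_eq a := by rw [← hφ, ← h, comp_whiskerRight_assoc]

lemma isCocone_inv_map [∀ a a', IsIso (F.map a a')] (a : A) :
    S.IsCocone (y := F.obj a) (S.θ a) (fun a' => S.P a' ◁ inv (F.map a' a) ≫ S.π.act a' a) where
  act_comp a₁ a₂ := by
    have inv_map_comp : (a₁ ⟶[V] a₂) ◁ inv (F.map a₂ a) ≫ eComp V a₁ a₂ a =
        F.map a₁ a₂ ▷ _ ≫ eComp V (F.obj a₁) (F.obj a₂) (F.obj a) ≫ inv (F.map a₁ a) := by
      rw [← cancel_mono (F.map a₁ a)]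
      simp [MonoidalCategory.tensorHom_def, ← whisker_exchange_assoc]
    rw [← whisker_exchange_assoc, S.π.act_comp, associator_naturality_right_assoc,
      ← whiskerLeft_comp_assoc, inv_map_comp]
    simp
  act_eq a' := by
    have hθ := S.isLinear_θ a' a
    rw [RightAction.restrict_act, Category.assoc] at hθ
    rw [← whisker_exchange_assoc, ← cancel_epi (S.N (F.obj a') ◁ F.map a' a), ← hθ]
    simp [whisker_exchange_assoc]

section Colimit

variable [HasColimitsOfSize.{w, w} V]

/-- The underlying family of the universal `B`-module under `N` to whose restriction `P` maps: the
pushout of `N` along the map induced by `θ` between left Kan extensions along `F`. -/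
def extension (y : B) : V := multicoequalizer (S.index y)

/-- The structure map of the extension at `N`. -/
def inclN (y : B) : S.N y ⟶ S.extension y := Multicoequalizer.π (S.index y) none

/-- The structure map of the extension at a summand of the Kan extension of `P`. -/
def inclP (a : A) (y : B) : S.P a ⊗ (F.obj a ⟶[V] y) ⟶ S.extension y :=
  Multicoequalizer.π (S.index y) (some a)

lemma isCocone_incl (y : B) : S.IsCocone (S.inclN y) (fun a => S.inclP a y) where
  act_comp a a' :=
    (Multicoequalizer.condition (S.index y) (Sum.inl (a, a'))).trans (Category.assoc _ _ _)
  act_eq a := Multicoequalizer.condition (S.index y) (Sum.inr a)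

variable {S}

lemma hom_ext {y : B} {X : V} {f g : S.extension y ⟶ X} (hN : S.inclN y ≫ f = S.inclN y ≫ g)
    (hP : ∀ a, S.inclP a y ≫ f = S.inclP a y ≫ g) : f = g := by
  refine Multicoequalizer.hom_ext (S.index y) f g ?_
  rintro (_ | a)
  · exact hN
  · exact hP a

section Desc

variable {y : B} {X : V} {k : S.N y ⟶ X} {l : ∀ a, S.P a ⊗ (F.obj a ⟶[V] y) ⟶ X}

/-- The morphism out of the extension determined by a cocone. -/
def desc (h : S.IsCocone k l) : S.extension y ⟶ X :=
  Multicoequalizer.desc (S.index y) X (fun o => match o with | none => k | some a => l a) <| by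
    rintro (⟨a, a'⟩ | a)
    · exact (h.act_comp a a').trans (Category.assoc _ _ _).symm
    · exact h.act_eq a

lemma inclN_desc (h : S.IsCocone k l) : S.inclN y ≫ desc h = k :=
  Multicoequalizer.π_desc (S.index y) _ _ _ none

lemma inclP_desc (h : S.IsCocone k l) (a : A) : S.inclP a y ≫ desc h = l a :=
  Multicoequalizer.π_desc (S.index y) _ _ _ (some a)

end Desc

variable (S)

/-- The universal map from `P` to the restriction of the extension. -/
def unit (a : A) : S.P a ⟶ S.extension (F.obj a) :=
  (ρ_ _).inv ≫ S.P a ◁ eId V (F.obj a) ≫ S.inclP a (F.obj a)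

lemma θ_unit (a : A) : S.θ a ≫ S.unit a = S.inclN (F.obj a) := by
  rw [unit, rightUnitor_inv_naturality_assoc, ← whisker_exchange_assoc,
    ← (S.isCocone_incl _).act_eq, reassoc_of% S.ν.act_id, Iso.inv_hom_id_assoc]

lemma whiskerLeft_map_inclP (a a' : A) :
    S.P a ◁ F.map a a' ≫ S.inclP a (F.obj a') = S.π.act a a' ≫ S.unit a' := by
  rw [unit, rightUnitor_inv_naturality_assoc, ← whisker_exchange_assoc,
    (S.isCocone_incl _).act_comp, associator_naturality_right_assoc,
    ← whiskerLeft_comp_assoc, whisker_exchange_assoc, whiskerLeft_eId_eComp]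
  simp

lemma isIso_unit [∀ a a', IsIso (F.map a a')] (a : A) : IsIso (S.unit a) := by
  refine ⟨desc (S.isCocone_inv_map a), ?_, ?_⟩
  · have eId_inv_map : eId V (F.obj a) ≫ inv (F.map a a) = eId V a := by
      rw [IsIso.comp_inv_eq, F.map_id]
    rw [unit, Category.assoc, Category.assoc, inclP_desc, ← whiskerLeft_comp_assoc, eId_inv_map,
      S.π.act_id, Iso.inv_hom_id]
  · apply hom_ext
    · rw [reassoc_of% (inclN_desc (S.isCocone_inv_map a)), θ_unit, Category.comp_id]
    · intro a'
      rw [reassoc_of% (inclP_desc (S.isCocone_inv_map a)), ← whiskerLeft_map_inclP,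
        ← whiskerLeft_comp_assoc, IsIso.inv_hom_id]
      simp

end Colimit

variable [HasColimitsOfSize.{w, w} V] [∀ X : V, (tensorRight X).IsLeftAdjoint]

variable {S} in
lemma tensor_hom_ext {y : B} {L X : V} {f g : S.extension y ⊗ L ⟶ X}
    (hN : S.inclN y ▷ L ≫ f = S.inclN y ▷ L ≫ g)
    (hP : ∀ a, S.inclP a y ▷ L ≫ f = S.inclP a y ▷ L ≫ g) : f = g := by
  apply rightCurry.injective
  apply hom_ext
  · rw [← rightCurry_whiskerRight_comp, hN, rightCurry_whiskerRight_comp]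
  · intro a
    rw [← rightCurry_whiskerRight_comp, hP, rightCurry_whiskerRight_comp]

lemma isCocone_act (y z : B) :
    S.IsCocone (rightCurry (S.ν.act y z ≫ S.inclN z)) (fun a => rightCurry
      ((α_ _ _ _).hom ≫ S.P a ◁ eComp V (F.obj a) y z ≫ S.inclP a z)) where
  act_comp a a' := by
    have map_eComp_eComp :
        ((F.map a a' ▷ (F.obj a' ⟶[V] y) ≫ eComp V (F.obj a) (F.obj a') y) ▷ (y ⟶[V] z)) ≫
          eComp V (F.obj a) y z = (α_ _ _ _).hom ≫ (a ⟶[V] a') ◁ eComp V (F.obj a') y z ≫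
            F.map a a' ▷ _ ≫ eComp V (F.obj a) (F.obj a') z := by
      rw [comp_whiskerRight, Category.assoc, ← e_assoc', associator_naturality_left_assoc,
        ← whisker_exchange_assoc]
    simp only [← rightCurry_whiskerRight_comp]
    rw [associator_naturality_left_assoc, ← whisker_exchange_assoc,
      (S.isCocone_incl z).act_comp, associator_naturality_middle_assoc,
      ← whiskerLeft_comp_assoc, map_eComp_eComp]
    simp
  act_eq a := by
    rw [← rightCurry_whiskerRight_comp, ← rightCurry_whiskerRight_comp,
      reassoc_of% S.ν.act_comp, (S.isCocone_incl z).act_eq,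
      associator_naturality_left_assoc, whisker_exchange_assoc]

/-- The action of `B` on the extension. -/
def extAct (y z : B) : S.extension y ⊗ (y ⟶[V] z) ⟶ S.extension z :=
  rightCurry.symm (desc (S.isCocone_act y z))

lemma inclN_extAct (y z : B) :
    S.inclN y ▷ _ ≫ S.extAct y z = S.ν.act y z ≫ S.inclN z := by
  apply rightCurry.injective
  rw [rightCurry_whiskerRight_comp, extAct, Equiv.apply_symm_apply, inclN_desc]

lemma inclP_extAct (a : A) (y z : B) :
    S.inclP a y ▷ _ ≫ S.extAct y z =
      (α_ _ _ _).hom ≫ S.P a ◁ eComp V (F.obj a) y z ≫ S.inclP a z := by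
  apply rightCurry.injective
  rw [rightCurry_whiskerRight_comp, extAct, Equiv.apply_symm_apply, inclP_desc]

/-- The module structure on the extension. -/
@[simps]
def extAction : RightAction B S.extension where
  act := S.extAct
  act_id y := by
    apply tensor_hom_ext
    · rw [← whisker_exchange_assoc, inclN_extAct, reassoc_of% S.ν.act_id, rightUnitor_naturality]
    · intro a
      rw [← whisker_exchange_assoc, inclP_extAct, rightUnitor_naturality,
        associator_naturality_right_assoc, ← whiskerLeft_comp_assoc, whiskerLeft_eId_eComp]
      simp
  act_comp x y z := by
    rw [← cancel_epi (α_ _ _ _).inv, Iso.inv_hom_id_assoc]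
    apply tensor_hom_ext
    · rw [associator_inv_naturality_left_assoc, ← comp_whiskerRight_assoc, inclN_extAct,
        comp_whiskerRight_assoc, inclN_extAct, reassoc_of% S.ν.act_comp, Iso.inv_hom_id_assoc,
        ← whisker_exchange_assoc, inclN_extAct]
    · intro a
      have eComp_assoc := congrArg (fun t => S.P a ◁ t ≫ S.inclP a z) (e_assoc V (F.obj a) x y z)
      simp only [whiskerLeft_comp, Category.assoc] at eComp_assoc
      rw [associator_inv_naturality_left_assoc, ← comp_whiskerRight_assoc, inclP_extAct,
        ← whisker_exchange_assoc, inclP_extAct, associator_naturality_right_assoc]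
      simp only [comp_whiskerRight, Category.assoc, inclP_extAct]
      simp [eComp_assoc]

lemma isLinear_inclN : S.ν.IsLinear S.extAction S.inclN := fun _ _ => S.inclN_extAct _ _

lemma unit_extAct (a : A) (y : B) : S.unit a ▷ _ ≫ S.extAct (F.obj a) y = S.inclP a y := by
  simp only [unit, comp_whiskerRight, Category.assoc, inclP_extAct]
  rw [associator_naturality_middle_assoc, ← whiskerLeft_comp_assoc, eId_whiskerRight_eComp]
  simp

lemma isLinear_unit : S.π.IsLinear (S.extAction.restrict F) S.unit := by
  intro a a'
  rw [RightAction.restrict_act, extAction_act, ← whisker_exchange_assoc, unit_extAct,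
    whiskerLeft_map_inclP]

section UniversalProperty

variable {S} {R : B → V} {ρ : RightAction B R}

lemma isLinear_hom_ext {φ ψ : ∀ y, S.extension y ⟶ R y}
    (hφ : S.extAction.IsLinear ρ φ) (hψ : S.extAction.IsLinear ρ ψ)
    (hN : ∀ y, S.inclN y ≫ φ y = S.inclN y ≫ ψ y)
    (hP : ∀ a, S.unit a ≫ φ (F.obj a) = S.unit a ≫ ψ (F.obj a)) (y : B) : φ y = ψ y := by
  refine hom_ext (hN y) (fun a => ?_)
  have hφ' := hφ (F.obj a) y
  have hψ' := hψ (F.obj a) y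
  rw [extAction_act] at hφ' hψ'
  rw [← unit_extAct, Category.assoc, Category.assoc, ← hφ', ← hψ', ← comp_whiskerRight_assoc, hP,
    comp_whiskerRight_assoc]

lemma exists_isLinear_desc {φ : ∀ y, S.N y ⟶ R y} (hφ : S.ν.IsLinear ρ φ)
    {ψ : ∀ a, S.P a ⟶ R (F.obj a)} (hψ : S.π.IsLinear (ρ.restrict F) ψ)
    (h : ∀ a, S.θ a ≫ ψ a = φ (F.obj a)) :
    ∃ χ : ∀ y, S.extension y ⟶ R y, S.extAction.IsLinear ρ χ ∧ (∀ y, S.inclN y ≫ χ y = φ y) ∧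
      ∀ a, S.unit a ≫ χ (F.obj a) = ψ a := by
  have hcocone := isCocone_of_isLinear hφ hψ h
  refine ⟨fun y => desc (hcocone y), fun y z => ?_, fun y => inclN_desc _, fun a => ?_⟩
  · apply tensor_hom_ext
    · rw [extAction_act, reassoc_of% S.inclN_extAct, inclN_desc, ← hφ, ← comp_whiskerRight_assoc,
        inclN_desc]
    · intro a
      rw [extAction_act, reassoc_of% S.inclP_extAct, inclP_desc, ← comp_whiskerRight_assoc,
        inclP_desc, comp_whiskerRight_assoc, ρ.act_comp, associator_naturality_left_assoc,
        whisker_exchange_assoc]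
  · rw [unit, Category.assoc, Category.assoc, inclP_desc, whisker_exchange_assoc, ρ.act_id,
      rightUnitor_naturality, Iso.inv_hom_id_assoc]

end UniversalProperty

end ModuleSpan

end Extension

section Kan

variable [HasColimitsOfSize.{w, w} V] [∀ X : V, (tensorRight X).IsLeftAdjoint]
  {A : Type w} [EnrichedCategory V A] {B : Type u₁} [EnrichedCategory V B]

/-- The span whose extension is the left Kan extension of the module `π` along `F`. -/
def kanSpan (F : EnrichedFunctor V A B) {P : A → V} (π : RightAction A P) : ModuleSpan F where
  N _ := ⊥_ V
  ν := RightAction.initial B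
  P := P
  π := π
  θ _ := initial.to _
  isLinear_θ _ _ := initial_tensor_hom_ext _ _

variable {F : EnrichedFunctor V A B} {P : A → V} {π : RightAction A P} {R : B → V}
  {ρ : RightAction B R}

lemma kanSpan_hom_ext {φ ψ : ∀ y, (kanSpan F π).extension y ⟶ R y}
    (hφ : (kanSpan F π).extAction.IsLinear ρ φ) (hψ : (kanSpan F π).extAction.IsLinear ρ ψ)
    (h : ∀ a, (kanSpan F π).unit a ≫ φ (F.obj a) = (kanSpan F π).unit a ≫ ψ (F.obj a)) (y : B) :
    φ y = ψ y :=
  ModuleSpan.isLinear_hom_ext hφ hψ (fun _ => initialIsInitial.hom_ext _ _) h y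

lemma exists_isLinear_kanSpan_desc {ψ : ∀ a, P a ⟶ R (F.obj a)}
    (hψ : π.IsLinear (ρ.restrict F) ψ) :
    ∃ χ : ∀ y, (kanSpan F π).extension y ⟶ R y, (kanSpan F π).extAction.IsLinear ρ χ ∧
      ∀ a, (kanSpan F π).unit a ≫ χ (F.obj a) = ψ a := by
  obtain ⟨χ, hχ, -, hunit⟩ := (kanSpan F π).exists_isLinear_desc (φ := fun _ => initial.to _)
    (fun _ _ => initial_tensor_hom_ext _ _) hψ (fun _ => initialIsInitial.hom_ext _ _)
  exact ⟨χ, hχ, hunit⟩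

end Kan

/-! ### Modules over the pushout -/

/-- A `V`-functor with prescribed action on objects. -/
@[ext]
structure FunctorOn (V : Type v) [Category.{w} V] [MonoidalCategory V] {A : Type u₁}
    {X : Type u₂} [EnrichedCategory V A] [EnrichedCategory V X] (o : A → X) where
  map : ∀ a b : A, (a ⟶[V] b) ⟶ (o a ⟶[V] o b)
  map_id : ∀ a, eId V a ≫ map a a = eId V (o a)
  map_comp : ∀ a b c, eComp V a b c ≫ map a c =
    (map a b ⊗ₘ map b c) ≫ eComp V (o a) (o b) (o c)

/-- The underlying `V`-functor. -/
abbrev FunctorOn.functor {A : Type u₁} {X : Type u₂} [EnrichedCategory V A]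
    [EnrichedCategory V X] {o : A → X} (F : FunctorOn V o) : EnrichedFunctor V A X where
  obj := o
  map := F.map
  map_id := F.map_id
  map_comp := F.map_comp

/-- A `V`-functor, as a `V`-functor with its own action on objects prescribed. -/
def FunctorOn.of {A : Type u₁} {X : Type u₂} [EnrichedCategory V A] [EnrichedCategory V X]
    (F : EnrichedFunctor V A X) : FunctorOn V F.obj where
  map := F.map
  map_id := F.map_id
  map_comp := F.map_comp

lemma FunctorOn.exists_functor_eq {A : Type u₁} {X : Type u₂} [EnrichedCategory V A]
    [EnrichedCategory V X] (F : EnrichedFunctor V A X) {o : A → X} (h : F.obj = o) :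
    ∃ G : FunctorOn V o, G.functor = F := by
  subst h
  exact ⟨FunctorOn.of F, rfl⟩

section Gluing

variable {A B' C : Type w} [EnrichedCategory V A] [EnrichedCategory V (A ⊕ B')]
  [EnrichedCategory V C]

/-- The map from the objects of `B`, written as `A ⊕ B'`, to the objects of the pushout. -/
abbrev glue (f : EnrichedFunctor V A C) : A ⊕ B' → C ⊕ B'
  | Sum.inl a => Sum.inl (f.obj a)
  | Sum.inr b => Sum.inr b

/-- A module over the pushout of `f` and of an inclusion `j : A → B` which is `Sum.inl` on objects,
before the pushout itself is available: a family of objects of `V` indexed by the objects of the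
pushout, with module structures over `C` and over `B` which agree over `A`. -/
structure GluedModule (j : FunctorOn V (Sum.inl : A → A ⊕ B')) (f : EnrichedFunctor V A C) where
  obj : C ⊕ B' → V
  actC : RightAction C (fun c => obj (Sum.inl c))
  actB : RightAction (A ⊕ B') (fun y => obj (glue f y))
  compat : actB.restrict j.functor = actC.restrict f

variable {j : FunctorOn V (Sum.inl : A → A ⊕ B')} {f : EnrichedFunctor V A C}

namespace GluedModule

/-- The tensor of a glued module with an object of `V`. -/
def tensor (K : V) (Q : GluedModule j f) : GluedModule j f where
  obj x := K ⊗ Q.obj x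
  actC := Q.actC.tensor K
  actB := Q.actB.tensor K
  compat := (Q.actB.restrict_tensor K j.functor).trans
    ((congrArg (RightAction.tensor K) Q.compat).trans (Q.actC.restrict_tensor K f).symm)

/-- A family of morphisms which is linear over both `C` and `A ⊕ B'`. -/
structure IsHom (Q R : GluedModule j f) (φ : ∀ x, Q.obj x ⟶ R.obj x) : Prop where
  isLinearC : Q.actC.IsLinear R.actC (fun c => φ (Sum.inl c))
  isLinearB : Q.actB.IsLinear R.actB (fun y => φ (glue f y))

variable {Q R S : GluedModule j f}

lemma IsHom.id (Q : GluedModule j f) : Q.IsHom Q (fun _ => 𝟙 _) :=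
  ⟨RightAction.IsLinear.id _, RightAction.IsLinear.id _⟩

lemma IsHom.comp {φ : ∀ x, Q.obj x ⟶ R.obj x} {ψ : ∀ x, R.obj x ⟶ S.obj x}
    (hφ : Q.IsHom R φ) (hψ : R.IsHom S ψ) : Q.IsHom S (fun x => φ x ≫ ψ x) :=
  ⟨hφ.isLinearC.comp hψ.isLinearC, hφ.isLinearB.comp hψ.isLinearB⟩

lemma IsHom.whiskerLeft (K : V) {φ : ∀ x, Q.obj x ⟶ R.obj x} (hφ : Q.IsHom R φ) :
    (Q.tensor K).IsHom (R.tensor K) (fun x => K ◁ φ x) :=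
  ⟨hφ.isLinearC.whiskerLeft K, hφ.isLinearB.whiskerLeft K⟩

lemma isHom_whiskerRight {K L : V} (k : K ⟶ L) (Q : GluedModule j f) :
    (Q.tensor K).IsHom (Q.tensor L) (fun x => k ▷ Q.obj x) :=
  ⟨Q.actC.isLinear_whiskerRight k, Q.actB.isLinear_whiskerRight k⟩

lemma isHom_associator (K L : V) (Q : GluedModule j f) :
    (Q.tensor (K ⊗ L)).IsHom ((Q.tensor L).tensor K) (fun x => (α_ K L (Q.obj x)).hom) :=
  ⟨Q.actC.isLinear_associator K L, Q.actB.isLinear_associator K L⟩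

lemma isHom_leftUnitor_inv (Q : GluedModule j f) :
    Q.IsHom (Q.tensor (𝟙_ V)) (fun x => (λ_ (Q.obj x)).inv) :=
  ⟨Q.actC.isLinear_leftUnitor_inv, Q.actB.isLinear_leftUnitor_inv⟩

section Closed

variable [MonoidalClosed V]

/-- The cotensor of a glued module with an object of `V`. -/
def ihom (K : V) (R : GluedModule j f) : GluedModule j f where
  obj x := (CategoryTheory.ihom K).obj (R.obj x)
  actC := R.actC.ihom K
  actB := R.actB.ihom K
  compat := (R.actB.restrict_ihom K j.functor).trans
    ((congrArg (RightAction.ihom K) R.compat).trans (R.actC.restrict_ihom K f).symm)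

lemma isHom_curry_iff {K : V} {φ : ∀ x, K ⊗ Q.obj x ⟶ R.obj x} :
    Q.IsHom (R.ihom K) (fun x => MonoidalClosed.curry (φ x)) ↔ (Q.tensor K).IsHom R φ :=
  ⟨fun h => ⟨RightAction.isLinear_curry_iff.1 h.1, RightAction.isLinear_curry_iff.1 h.2⟩,
    fun h => ⟨RightAction.isLinear_curry_iff.2 h.1, RightAction.isLinear_curry_iff.2 h.2⟩⟩

end Closed

lemma isLinear_restrictC (R : GluedModule j f) {M : C → V} {μ : RightAction C M}
    {φ : ∀ c, M c ⟶ R.obj (Sum.inl c)} (hφ : μ.IsLinear R.actC φ) :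
    (μ.restrict f).IsLinear (R.actB.restrict j.functor) (fun a => φ (f.obj a)) := by
  rw [R.compat]
  exact hφ.restrict f

lemma isLinear_restrictB (R : GluedModule j f) {N : A ⊕ B' → V} {ν : RightAction (A ⊕ B') N}
    {φ : ∀ y, N y ⟶ R.obj (glue f y)} (hφ : ν.IsLinear R.actB φ) :
    (ν.restrict j.functor).IsLinear (R.actC.restrict f) (fun a => φ (Sum.inl a)) := by
  rw [← R.compat]
  exact hφ.restrict j.functor

end GluedModule

/-- A module `M` over `C` and a module `N` over `A ⊕ B'` whose restrictions to `A` are related by a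
linear map `θ`, not necessarily an isomorphism. -/
structure LaxGluedModule (j : FunctorOn V (Sum.inl : A → A ⊕ B')) (f : EnrichedFunctor V A C) where
  M : C → V
  μ : RightAction C M
  N : A ⊕ B' → V
  ν : RightAction (A ⊕ B') N
  θ : ∀ a, N (Sum.inl a) ⟶ M (f.obj a)
  isLinear_θ : (ν.restrict j.functor).IsLinear (μ.restrict f) θ

namespace LaxGluedModule

/-- The span whose extension corrects the module `N` of a lax glued module. -/
abbrev span (L : LaxGluedModule j f) : ModuleSpan j.functor where
  N := L.N
  ν := L.ν
  P a := L.M (f.obj a)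
  π := L.μ.restrict f
  θ := L.θ
  isLinear_θ := L.isLinear_θ

variable [HasColimitsOfSize.{w, w} V] [∀ a a', IsIso (j.map a a')] (L : LaxGluedModule j f)

/-- Extension along a full and faithful inclusion does not change `M`. -/
def unitIso (a : A) : L.M (f.obj a) ≅ L.span.extension (Sum.inl a) :=
  @asIso _ _ _ _ (L.span.unit a) (L.span.isIso_unit a)

/-- The comparison of the extended `A ⊕ B'`-module with a family which takes the values of `M` on
`A`. -/
def extIso (y : A ⊕ B') :
    L.span.extension y ≅ Sum.elim L.M (fun b => L.span.extension (Sum.inr b)) (glue f y) :=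
  match y with
  | Sum.inl a => (L.unitIso a).symm
  | Sum.inr b => Iso.refl (L.span.extension (Sum.inr b))

/-- The map from `N` to the glued module generated by a lax glued module. -/
def incl (y : A ⊕ B') : L.N y ⟶ Sum.elim L.M (fun b => L.span.extension (Sum.inr b)) (glue f y) :=
  L.span.inclN y ≫ (L.extIso y).hom

lemma incl_inl (a : A) : L.incl (Sum.inl a) = L.θ a := by
  have hθ : L.θ a ≫ (L.unitIso a).hom = L.span.inclN (Sum.inl a) := L.span.θ_unit a
  exact (Iso.comp_inv_eq _).2 hθ.symm

variable [∀ X : V, (tensorRight X).IsLeftAdjoint]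

/-- The glued module freely generated by a lax glued module. -/
def strictify : GluedModule j f where
  obj := Sum.elim L.M (fun b => L.span.extension (Sum.inr b))
  actC := L.μ
  actB := L.span.extAction.transport L.extIso
  compat := by
    ext a a'
    have hunit : (L.unitIso a).hom ▷ _ ≫ L.span.extension (Sum.inl a) ◁ j.map a a' ≫
        L.span.extAct (Sum.inl a) (Sum.inl a') =
          (L.μ.restrict f).act a a' ≫ (L.unitIso a').hom := L.span.isLinear_unit a a'
    have hM : L.M (f.obj a) ◁ j.map a a' ≫ (L.unitIso a).hom ▷ _ ≫
        L.span.extAct (Sum.inl a) (Sum.inl a') ≫ (L.unitIso a').inv =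
          (L.μ.restrict f).act a a' := by
      rw [whisker_exchange_assoc, reassoc_of% hunit, Iso.hom_inv_id, Category.comp_id]
    exact hM

lemma isLinear_incl : L.ν.IsLinear L.strictify.actB L.incl :=
  L.span.isLinear_inclN.comp (RightAction.isLinear_transport_hom L.extIso)

variable {L} {R : GluedModule j f}

lemma exists_isHom_strictify {φ : ∀ c, L.M c ⟶ R.obj (Sum.inl c)}
    (hφ : L.μ.IsLinear R.actC φ) {ψ : ∀ y, L.N y ⟶ R.obj (glue f y)}
    (hψ : L.ν.IsLinear R.actB ψ) (h : ∀ a, L.θ a ≫ φ (f.obj a) = ψ (Sum.inl a)) :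
    ∃ χ, L.strictify.IsHom R χ ∧ (∀ c, χ (Sum.inl c) = φ c) ∧
      ∀ y, L.incl y ≫ χ (glue f y) = ψ y := by
  obtain ⟨χ, hχ, hχN, hχP⟩ :=
    L.span.exists_isLinear_desc hψ (R.isLinear_restrictC hφ) h
  let ω : ∀ x, L.strictify.obj x ⟶ R.obj x
    | Sum.inl c => φ c
    | Sum.inr b => χ (Sum.inr b)
  have hω (y : A ⊕ B') : (L.extIso y).hom ≫ ω (glue f y) = χ y := by
    rcases y with a | b
    · exact (Iso.inv_comp_eq (L.unitIso a)).2 (hχP a).symm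
    · exact Category.id_comp _
  have hωinv : (fun y => (L.extIso y).inv ≫ χ y) = fun y => ω (glue f y) :=
    funext fun y => (Iso.inv_comp_eq _).2 (hω y).symm
  refine ⟨ω, ⟨hφ, hωinv ▸ (RightAction.isLinear_transport_inv L.extIso).comp hχ⟩, fun _ => rfl,
    fun y => ?_⟩
  exact (Category.assoc _ _ _).trans ((congrArg (_ ≫ ·) (hω y)).trans (hχN y))

lemma strictify_hom_ext {φ ψ : ∀ x, L.strictify.obj x ⟶ R.obj x} (hφ : L.strictify.IsHom R φ)
    (hψ : L.strictify.IsHom R ψ) (hC : ∀ c, φ (Sum.inl c) = ψ (Sum.inl c))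
    (hB : ∀ y, L.incl y ≫ φ (glue f y) = L.incl y ≫ ψ (glue f y)) (x : C ⊕ B') : φ x = ψ x := by
  have isLinear_extIso_comp {χ : ∀ x, L.strictify.obj x ⟶ R.obj x} (hχ : L.strictify.IsHom R χ) :
      L.span.extAction.IsLinear R.actB (fun y => (L.extIso y).hom ≫ χ (glue f y)) :=
    (RightAction.isLinear_transport_hom L.extIso).comp hχ.isLinearB
  have hext := ModuleSpan.isLinear_hom_ext (isLinear_extIso_comp hφ) (isLinear_extIso_comp hψ)
    (fun y => (Category.assoc _ _ _).symm.trans ((hB y).trans (Category.assoc _ _ _)))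
    (fun a => congrArg (fun t => L.span.unit a ≫ (L.extIso (Sum.inl a)).hom ≫ t) (hC (f.obj a)))
  rcases x with c | b
  · exact hC c
  · exact (cancel_epi (L.extIso (Sum.inr b)).hom).1 (hext (Sum.inr b))

end LaxGluedModule

namespace GluedModule

/-- A glued module representing the evaluation of glued modules at `x`. -/
structure Representation (j : FunctorOn V (Sum.inl : A → A ⊕ B')) (f : EnrichedFunctor V A C)
    (x : C ⊕ B') where
  Q : GluedModule j f
  elt : 𝟙_ V ⟶ Q.obj x
  exists_hom : ∀ (R : GluedModule j f) (e : 𝟙_ V ⟶ R.obj x), ∃ φ, Q.IsHom R φ ∧ elt ≫ φ x = e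
  hom_ext : ∀ {R : GluedModule j f} {φ ψ : ∀ y, Q.obj y ⟶ R.obj y}, Q.IsHom R φ → Q.IsHom R ψ →
    elt ≫ φ x = elt ≫ ψ x → ∀ y, φ y = ψ y

section Existence

variable [HasColimitsOfSize.{w, w} V] [∀ X : V, (tensorRight X).IsLeftAdjoint]
  [∀ a a', IsIso (j.map a a')]

variable (j f) in
/-- The generators of the glued module represented by an object `c` of `C`: the module represented
by `c`, and no elements over `A ⊕ B'`. -/
def laxRepresentableC (c : C) : LaxGluedModule j f where
  M c' := (c ⟶[V] c')
  μ := RightAction.representable c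
  N _ := ⊥_ V
  ν := RightAction.initial _
  θ _ := initial.to _
  isLinear_θ _ _ := initial_tensor_hom_ext _ _

variable (j f) in
/-- Evaluation at an object of `C` is representable, by a module which extends the module
represented in `C`. -/
def representationC (c : C) : Representation j f (Sum.inl c) where
  Q := (laxRepresentableC j f c).strictify
  elt := eId V c
  exists_hom R e := by
    obtain ⟨χ, hχ, hχC, -⟩ := LaxGluedModule.exists_isHom_strictify
      (L := laxRepresentableC j f c) (R.actC.isLinear_yonedaHom e) (ψ := fun _ => initial.to _)
      (fun _ _ => initial_tensor_hom_ext _ _) (fun _ => initialIsInitial.hom_ext _ _)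
    refine ⟨χ, hχ, ?_⟩
    rw [hχC]
    exact R.actC.eId_yonedaHom e
  hom_ext hφ hψ h := LaxGluedModule.strictify_hom_ext hφ hψ
    (hφ.isLinearC.representable_ext hψ.isLinearC h) (fun _ => initialIsInitial.hom_ext _ _)

variable (j f) in
/-- The span whose extension is the left Kan extension along `f` of the restriction to `A` of the
module represented by `b`. -/
abbrev kanRepresentable (b : B') : ModuleSpan f :=
  kanSpan f ((RightAction.representable (V := V) (Sum.inr b : A ⊕ B')).restrict j.functor)

variable (j f) in
/-- The generators of the glued module represented by an object `b` of `B'`: the module represented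
by `b` in `A ⊕ B'`, and the left Kan extension along `f` of its restriction to `A`. -/
def laxRepresentableB (b : B') : LaxGluedModule j f where
  M := (kanRepresentable j f b).extension
  μ := (kanRepresentable j f b).extAction
  N y := ((Sum.inr b : A ⊕ B') ⟶[V] y)
  ν := RightAction.representable (Sum.inr b)
  θ := (kanRepresentable j f b).unit
  isLinear_θ := (kanRepresentable j f b).isLinear_unit

variable (j f) in
/-- Evaluation at an object of `B'` is representable. -/
def representationB (b : B') : Representation j f (Sum.inr b) where
  Q := (laxRepresentableB j f b).strictify
  elt := eId V (Sum.inr b : A ⊕ B') ≫ (laxRepresentableB j f b).incl (Sum.inr b)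
  exists_hom R e := by
    have hψ := R.actB.isLinear_yonedaHom (b := Sum.inr b) e
    obtain ⟨φ, hφ, hφunit⟩ := exists_isLinear_kanSpan_desc (R.isLinear_restrictB hψ)
    obtain ⟨χ, hχ, -, hχB⟩ := LaxGluedModule.exists_isHom_strictify
      (L := laxRepresentableB j f b) hφ hψ hφunit
    refine ⟨χ, hχ, (Category.assoc _ _ _).trans ?_⟩
    exact (congrArg (_ ≫ ·) (hχB (Sum.inr b))).trans
      (R.actB.eId_yonedaHom (b := Sum.inr b) e)
  hom_ext {R φ ψ} hφ hψ h := by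
    have hB := RightAction.IsLinear.representable_ext
      ((laxRepresentableB j f b).isLinear_incl.comp hφ.isLinearB)
      ((laxRepresentableB j f b).isLinear_incl.comp hψ.isLinearB)
      ((Category.assoc _ _ _).symm.trans (h.trans (Category.assoc _ _ _)))
    refine LaxGluedModule.strictify_hom_ext hφ hψ
      (kanSpan_hom_ext hφ.isLinearC hψ.isLinearC fun a => ?_) hB
    have hBa := hB (Sum.inl a)
    rw [LaxGluedModule.incl_inl] at hBa
    exact hBa

variable (j f) in
/-- All evaluations of glued modules are representable. -/
def representation : ∀ x, Representation j f x
  | Sum.inl c => representationC j f c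
  | Sum.inr b => representationB j f b

end Existence

/-! ### The pushout as a category of representables -/

section Composition

variable [MonoidalClosed V]

namespace Representation

variable {x : C ⊕ B'} (r : Representation j f x)

lemma exists_isHom_tensor {K : V} {R : GluedModule j f} (k : K ⟶ R.obj x) :
    ∃ φ, (r.Q.tensor K).IsHom R φ ∧ K ◁ r.elt ≫ φ x = (ρ_ K).hom ≫ k := by
  obtain ⟨φ, hφ, hφx⟩ := r.exists_hom (R.ihom K) (MonoidalClosed.curry ((ρ_ K).hom ≫ k))
  have curry_uncurry : φ = fun y => MonoidalClosed.curry (MonoidalClosed.uncurry (φ y)) :=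
    funext fun _ => (MonoidalClosed.curry_uncurry _).symm
  refine ⟨fun y => MonoidalClosed.uncurry (φ y), isHom_curry_iff.1 (curry_uncurry ▸ hφ), ?_⟩
  exact (MonoidalClosed.uncurry_natural_left _ _).symm.trans
    ((congrArg MonoidalClosed.uncurry hφx).trans (MonoidalClosed.uncurry_curry _))

variable {r}

lemma isHom_tensor_ext {K : V} {R : GluedModule j f} {φ ψ : ∀ y, K ⊗ r.Q.obj y ⟶ R.obj y}
    (hφ : (r.Q.tensor K).IsHom R φ) (hψ : (r.Q.tensor K).IsHom R ψ)
    (h : K ◁ r.elt ≫ φ x = K ◁ r.elt ≫ ψ x) (y : C ⊕ B') : φ y = ψ y := by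
  refine MonoidalClosed.curry_injective
    (r.hom_ext (isHom_curry_iff.2 hφ) (isHom_curry_iff.2 hψ) ?_ y)
  exact (MonoidalClosed.curry_natural_left _ _).symm.trans
    ((congrArg MonoidalClosed.curry h).trans (MonoidalClosed.curry_natural_left _ _))

end Representation

variable (r : ∀ x, Representation j f x)

/-- Composition in the pushout: the unique homomorphism of glued modules which is unital at the
universal element of the module represented by `y`. -/
def gluedComp (x y z : C ⊕ B') : (r x).Q.obj y ⊗ (r y).Q.obj z ⟶ (r x).Q.obj z :=
  ((r y).exists_isHom_tensor (𝟙 ((r x).Q.obj y))).choose z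

lemma isHom_gluedComp (x y : C ⊕ B') :
    ((r y).Q.tensor ((r x).Q.obj y)).IsHom (r x).Q (gluedComp r x y) :=
  ((r y).exists_isHom_tensor (𝟙 ((r x).Q.obj y))).choose_spec.1

lemma whiskerLeft_elt_gluedComp (x y : C ⊕ B') :
    (r x).Q.obj y ◁ (r y).elt ≫ gluedComp r x y y = (ρ_ _).hom :=
  ((r y).exists_isHom_tensor (𝟙 ((r x).Q.obj y))).choose_spec.2.trans (Category.comp_id _)

lemma elt_whiskerRight_gluedComp (x y : C ⊕ B') :
    (λ_ ((r x).Q.obj y)).inv ≫ (r x).elt ▷ _ ≫ gluedComp r x x y = 𝟙 _ := by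
  have isHom_elt_gluedComp : (r x).Q.IsHom (r x).Q
      (fun y => (λ_ ((r x).Q.obj y)).inv ≫ (r x).elt ▷ (r x).Q.obj y ≫ gluedComp r x x y) :=
    (isHom_leftUnitor_inv _).comp ((isHom_whiskerRight _ _).comp (isHom_gluedComp r x x))
  refine (r x).hom_ext isHom_elt_gluedComp (IsHom.id _) ?_ y
  rw [leftUnitor_inv_naturality_assoc, whisker_exchange_assoc, whiskerLeft_elt_gluedComp,
    rightUnitor_naturality]
  simp [unitors_inv_equal]

lemma gluedComp_assoc (x y y' z : C ⊕ B') :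
    gluedComp r x y y' ▷ (r y').Q.obj z ≫ gluedComp r x y' z =
      (α_ _ _ _).hom ≫ (r x).Q.obj y ◁ gluedComp r y y' z ≫ gluedComp r x y z := by
  have isHom_left : ((r y').Q.tensor ((r x).Q.obj y ⊗ (r y).Q.obj y')).IsHom (r x).Q
      (fun z => gluedComp r x y y' ▷ (r y').Q.obj z ≫ gluedComp r x y' z) :=
    (isHom_whiskerRight _ _).comp (isHom_gluedComp r x y')
  have isHom_right : ((r y').Q.tensor ((r x).Q.obj y ⊗ (r y).Q.obj y')).IsHom (r x).Q
      (fun z => (α_ _ _ _).hom ≫ (r x).Q.obj y ◁ gluedComp r y y' z ≫ gluedComp r x y z) :=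
    (isHom_associator _ _ _).comp
      (((isHom_gluedComp r y y').whiskerLeft _).comp (isHom_gluedComp r x y))
  have eq_at_elt : ((r x).Q.obj y ⊗ (r y).Q.obj y') ◁ (r y').elt ≫
      gluedComp r x y y' ▷ (r y').Q.obj y' ≫ gluedComp r x y' y' =
        ((r x).Q.obj y ⊗ (r y).Q.obj y') ◁ (r y').elt ≫
          (α_ _ _ _).hom ≫ (r x).Q.obj y ◁ gluedComp r y y' y' ≫ gluedComp r x y y' := by
    rw [whisker_exchange_assoc, whiskerLeft_elt_gluedComp, associator_naturality_right_assoc,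
      ← whiskerLeft_comp_assoc, whiskerLeft_elt_gluedComp]
    simp
  exact Representation.isHom_tensor_ext isHom_left isHom_right eq_at_elt z

/-- The set of objects `C ⊕ B'` of the pushout, carrying the `V`-category structure in which the
objects of morphisms with source `x` form the glued module represented by `x`. -/
@[nolint unusedArguments]
def Glued (_ : ∀ x, Representation j f x) : Type w := C ⊕ B'

instance : EnrichedCategory V (Glued r) where
  Hom x y := (r x).Q.obj y
  id x := (r x).elt
  comp := gluedComp r
  id_comp := elt_whiskerRight_gluedComp r
  comp_id x y := (Iso.inv_comp_eq _).2
    ((whiskerLeft_elt_gluedComp r x y).trans (Category.comp_id _).symm)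
  assoc w x y z := (Iso.inv_comp_eq _).2 (gluedComp_assoc r w x y z)

/-- An object of `C ⊕ B'`, regarded as an object of the pushout. -/
abbrev Glued.of (x : C ⊕ B') : Glued r := x

lemma whiskerLeft_yonedaHomC_gluedComp (x : C ⊕ B') (c c' : C) :
    (r x).Q.obj (Sum.inl c) ◁ (r (Sum.inl c)).Q.actC.yonedaHom (r (Sum.inl c)).elt c' ≫
      gluedComp r x (Sum.inl c) (Sum.inl c') = (r x).Q.actC.act c c' :=
  (isHom_gluedComp r x (Sum.inl c)).isLinearC.whiskerLeft_yonedaHom_comp (b := c)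
    (N := fun c => (r x).Q.obj (Sum.inl c)) (whiskerLeft_elt_gluedComp r x (Sum.inl c)) c'

lemma whiskerLeft_yonedaHomB_gluedComp (x : C ⊕ B') (y z : A ⊕ B') :
    (r x).Q.obj (glue f y) ◁ (r (glue f y)).Q.actB.yonedaHom (r (glue f y)).elt z ≫
      gluedComp r x (glue f y) (glue f z) = (r x).Q.actB.act y z :=
  (isHom_gluedComp r x (glue f y)).isLinearB.whiskerLeft_yonedaHom_comp (b := y)
    (N := fun y => (r x).Q.obj (glue f y)) (whiskerLeft_elt_gluedComp r x (glue f y)) z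

/-- The inclusion of `C` in the pushout. -/
def inclC : FunctorOn V (fun c : C => Glued.of r (Sum.inl c)) where
  map c c' := (r (Sum.inl c)).Q.actC.yonedaHom (r (Sum.inl c)).elt c'
  map_id c := (r (Sum.inl c)).Q.actC.eId_yonedaHom (r (Sum.inl c)).elt
  map_comp c c' c'' := by
    have h := ((r (Sum.inl c)).Q.actC.isLinear_yonedaHom (r (Sum.inl c)).elt c' c'').symm
    rw [← whiskerLeft_yonedaHomC_gluedComp, ← MonoidalCategory.tensorHom_def_assoc] at h
    exact h

/-- The map from `A ⊕ B'` to the pushout. -/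
def inclB : FunctorOn V (fun y : A ⊕ B' => Glued.of r (glue f y)) where
  map y z := (r (glue f y)).Q.actB.yonedaHom (r (glue f y)).elt z
  map_id y := (r (glue f y)).Q.actB.eId_yonedaHom (r (glue f y)).elt
  map_comp x y z := by
    have h := ((r (glue f x)).Q.actB.isLinear_yonedaHom (r (glue f x)).elt y z).symm
    rw [← whiskerLeft_yonedaHomB_gluedComp, ← MonoidalCategory.tensorHom_def_assoc] at h
    exact h

lemma map_comp_inclB (a a' : A) :
    j.map a a' ≫ (inclB r).map (Sum.inl a) (Sum.inl a') =
      f.map a a' ≫ (inclC r).map (f.obj a) (f.obj a') := by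
  let Q := (r (Sum.inl (f.obj a))).Q
  let u := (r (Sum.inl (f.obj a))).elt
  exact (Q.actB.map_comp_yonedaHom j.functor u a').trans
    ((congrArg (fun β : RightAction A (fun a => Q.obj (Sum.inl (f.obj a))) => β.yonedaHom u a')
      Q.compat).trans (Q.actC.map_comp_yonedaHom f u a').symm)

lemma inclB_inclC_comm : j.functor.comp V (inclB r).functor = f.comp V (inclC r).functor :=
  EnrichedFunctor.ext V (fun _ => rfl)
    (fun a a' => (Category.comp_id _).trans (map_comp_inclB r a a'))

end Composition

section UniversalProperty

variable {X : Type u₁} [EnrichedCategory V X]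

/-- A cocone under `j` and `f` in which the map on objects out of the pushout is prescribed. -/
structure GluedFunctor (j : FunctorOn V (Sum.inl : A → A ⊕ B')) (f : EnrichedFunctor V A C)
    (h : C ⊕ B' → X) where
  onC : FunctorOn V (fun c => h (Sum.inl c))
  onB : FunctorOn V (fun y => h (glue f y))
  comm : j.functor.comp V onB.functor = f.comp V onC.functor

namespace GluedFunctor

variable {h : C ⊕ B' → X} (G : GluedFunctor j f h)

lemma map_comp_onB (a b : A) : j.map a b ≫ G.onB.map (Sum.inl a) (Sum.inl b) =
    f.map a b ≫ G.onC.map (f.obj a) (f.obj b) := by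
  injection G.comm with _ hmap
  exact congrFun (congrFun hmap a) b

/-- The restriction of the module represented by `x` along a cocone. -/
def module (x : X) : GluedModule j f where
  obj y := (x ⟶[V] h y)
  actC := (RightAction.representable x).restrict G.onC.functor
  actB := (RightAction.representable x).restrict G.onB.functor
  compat := by
    ext a a'
    have whiskerLeft_map_comp := congrArg (fun t => (x ⟶[V] h (Sum.inl (f.obj a))) ◁ t ≫
      eComp V x _ (h (Sum.inl (f.obj a')))) (G.map_comp_onB a a')
    simp only [whiskerLeft_comp, Category.assoc] at whiskerLeft_map_comp
    exact whiskerLeft_map_comp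

lemma isHom_eComp (x y : X) : ((G.module y).tensor (x ⟶[V] y)).IsHom (G.module x)
    (fun z => eComp V x y (h z)) where
  isLinearC := by
    have hC := (RightAction.isLinear_eComp x y).restrict G.onC.functor
    rw [RightAction.restrict_tensor] at hC
    exact hC
  isLinearB := by
    have hB := (RightAction.isLinear_eComp x y).restrict G.onB.functor
    rw [RightAction.restrict_tensor] at hB
    exact hB

variable [MonoidalClosed V] {r : ∀ x, Representation j f x}

section

variable {G} {d : FunctorOn V (A := Glued r) h}

lemma inclC_comp_of_isHom (hd : ∀ x, (r x).Q.IsHom (G.module (h x)) (d.map x)) (c c' : C) :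
    (inclC r).map c c' ≫ d.map (Sum.inl c) (Sum.inl c') = G.onC.map c c' := by
  have elt_comp_map : (r (Sum.inl c)).elt ≫ d.map (Sum.inl c) (Sum.inl c) = eId V (h (Sum.inl c)) :=
    d.map_id (Sum.inl c)
  exact ((hd (Sum.inl c)).isLinearC.yonedaHom_comp (b := c) _ c').trans
    ((congrArg (fun e => (G.module (h (Sum.inl c))).actC.yonedaHom (b := c) e c')
      elt_comp_map).trans (RightAction.yonedaHom_restrict_representable_eId G.onC.functor c c'))

lemma inclB_comp_of_isHom (hd : ∀ x, (r x).Q.IsHom (G.module (h x)) (d.map x)) (y z : A ⊕ B') :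
    (inclB r).map y z ≫ d.map (glue f y) (glue f z) = G.onB.map y z := by
  have elt_comp_map : (r (glue f y)).elt ≫ d.map (glue f y) (glue f y) = eId V (h (glue f y)) :=
    d.map_id (glue f y)
  exact ((hd (glue f y)).isLinearB.yonedaHom_comp (b := y) _ z).trans
    ((congrArg (fun e => (G.module (h (glue f y))).actB.yonedaHom (b := y) e z)
      elt_comp_map).trans (RightAction.yonedaHom_restrict_representable_eId G.onB.functor y z))

lemma isHom_of_incl_comp
    (hC : ∀ c c', (inclC r).map c c' ≫ d.map (Sum.inl c) (Sum.inl c') = G.onC.map c c')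
    (hB : ∀ y z, (inclB r).map y z ≫ d.map (glue f y) (glue f z) = G.onB.map y z) (x : C ⊕ B') :
    (r x).Q.IsHom (G.module (h x)) (d.map x) := by
  let δ (x y : C ⊕ B') : (r x).Q.obj y ⟶ (h x ⟶[V] h y) := d.map x y
  have gluedComp_comp (y z : C ⊕ B') : gluedComp r x y z ≫ δ x z =
      δ x y ▷ _ ≫ (h x ⟶[V] h y) ◁ δ y z ≫ eComp V (h x) (h y) (h z) := by
    rw [← MonoidalCategory.tensorHom_def_assoc]
    exact d.map_comp x y z
  have comp_eq_of_act {y z : C ⊕ B'} {H : V} {m : H ⟶ (r y).Q.obj z}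
      {a : (r x).Q.obj y ⊗ H ⟶ (r x).Q.obj z} (ha : (r x).Q.obj y ◁ m ≫ gluedComp r x y z = a)
      {k : H ⟶ (h y ⟶[V] h z)} (hk : m ≫ δ y z = k) :
      δ x y ▷ H ≫ (h x ⟶[V] h y) ◁ k ≫ eComp V (h x) (h y) (h z) = a ≫ δ x z := by
    rw [← ha, Category.assoc, gluedComp_comp, whisker_exchange_assoc, ← whiskerLeft_comp_assoc, hk]
  exact ⟨fun c c' => comp_eq_of_act (whiskerLeft_yonedaHomC_gluedComp r x c c') (hC c c'),
    fun y z => comp_eq_of_act (whiskerLeft_yonedaHomB_gluedComp r x y z) (hB y z)⟩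

end

lemma gluedComp_comp_of_isHom {d : ∀ x y, (r x).Q.obj y ⟶ (h x ⟶[V] h y)}
    (hd : ∀ x, (r x).Q.IsHom (G.module (h x)) (d x))
    (elt_comp : ∀ x, (r x).elt ≫ d x x = eId V (h x)) (x y z : C ⊕ B') :
    gluedComp r x y z ≫ d x z = (d x y ⊗ₘ d y z) ≫ eComp V (h x) (h y) (h z) := by
  have isHom_left : ((r y).Q.tensor ((r x).Q.obj y)).IsHom (G.module (h x))
      (fun z => gluedComp r x y z ≫ d x z) := (isHom_gluedComp r x y).comp (hd x)
  have isHom_right : ((r y).Q.tensor ((r x).Q.obj y)).IsHom (G.module (h x))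
      (fun z => d x y ▷ _ ≫ (h x ⟶[V] h y) ◁ d y z ≫ eComp V (h x) (h y) (h z)) :=
    (isHom_whiskerRight (d x y) _).comp (((hd y).whiskerLeft _).comp (G.isHom_eComp (h x) (h y)))
  have eq_at_elt : (r x).Q.obj y ◁ (r y).elt ≫ gluedComp r x y y ≫ d x y =
      (r x).Q.obj y ◁ (r y).elt ≫ d x y ▷ _ ≫ (h x ⟶[V] h y) ◁ d y y ≫
        eComp V (h x) (h y) (h y) := by
    rw [reassoc_of% whiskerLeft_elt_gluedComp, whisker_exchange_assoc, ← whiskerLeft_comp_assoc,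
      elt_comp, whiskerLeft_eId_eComp, rightUnitor_naturality]
  rw [MonoidalCategory.tensorHom_def_assoc]
  exact Representation.isHom_tensor_ext isHom_left isHom_right eq_at_elt z

variable (r)

lemma exists_isHom : ∃ d : FunctorOn V (A := Glued r) h,
    ∀ x, (r x).Q.IsHom (G.module (h x)) (d.map x) := by
  choose d hd elt_comp using fun x : C ⊕ B' => (r x).exists_hom (G.module (h x)) (eId V (h x))
  exact ⟨⟨d, elt_comp, G.gluedComp_comp_of_isHom hd elt_comp⟩, hd⟩

lemma exists_desc : ∃ d : FunctorOn V (A := Glued r) h,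
    (inclC r).functor.comp V d.functor = G.onC.functor ∧
      (inclB r).functor.comp V d.functor = G.onB.functor := by
  obtain ⟨d, hd⟩ := G.exists_isHom r
  exact ⟨d, EnrichedFunctor.ext V (fun _ => rfl)
      (fun c c' => (Category.comp_id _).trans (inclC_comp_of_isHom hd c c')),
    EnrichedFunctor.ext V (fun _ => rfl)
      (fun y z => (Category.comp_id _).trans (inclB_comp_of_isHom hd y z))⟩

end GluedFunctor

variable [MonoidalClosed V] {r : ∀ x, Representation j f x}

/-- The restriction of a `V`-functor out of the pushout to a cocone. -/
def GluedFunctor.ofFunctorOn {h : C ⊕ B' → X} (d : FunctorOn V (A := Glued r) h) :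
    GluedFunctor j f h where
  onC := FunctorOn.of ((inclC r).functor.comp V d.functor)
  onB := FunctorOn.of ((inclB r).functor.comp V d.functor)
  comm := by
    have hcomm := congrArg (fun F => F.comp V d.functor) (inclB_inclC_comm r)
    simp only [EnrichedFunctor.comp, Category.assoc] at hcomm ⊢
    exact hcomm

lemma Glued.functorOn_ext {h : C ⊕ B' → X} {d d' : FunctorOn V (A := Glued r) h}
    (hC : (inclC r).functor.comp V d.functor = (inclC r).functor.comp V d'.functor)
    (hB : (inclB r).functor.comp V d.functor = (inclB r).functor.comp V d'.functor) : d = d' := by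
  let G := GluedFunctor.ofFunctorOn d
  injection hC with _ hC
  injection hB with _ hB
  have hd := GluedFunctor.isHom_of_incl_comp (G := G) (d := d) (fun _ _ => rfl) (fun _ _ => rfl)
  have hd' := GluedFunctor.isHom_of_incl_comp (G := G) (d := d')
    (fun c c' => (congrFun (congrFun hC c) c').symm) (fun y z => (congrFun (congrFun hB y) z).symm)
  ext x y
  exact (r x).hom_ext (hd x) (hd' x) ((d.map_id x).trans (d'.map_id x).symm) y

lemma Glued.hom_ext {d d' : EnrichedFunctor V (Glued r) X}
    (hC : (inclC r).functor.comp V d = (inclC r).functor.comp V d')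
    (hB : (inclB r).functor.comp V d = (inclB r).functor.comp V d') : d = d' := by
  have obj_eq : d'.obj = d.obj := by
    funext x
    rcases x with c | b
    · exact (congrArg (fun F => F.obj c) hC).symm
    · exact (congrArg (fun F => F.obj (Sum.inr b)) hB).symm
  obtain ⟨d', rfl⟩ := FunctorOn.exists_functor_eq d' obj_eq
  exact congrArg FunctorOn.functor (Glued.functorOn_ext (d := FunctorOn.of d) hC hB)

variable (r)

lemma Glued.exists_desc (κ : EnrichedFunctor V C X) (β : EnrichedFunctor V (A ⊕ B') X)
    (comm : j.functor.comp V β = f.comp V κ) :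
    ∃ d : EnrichedFunctor V (Glued r) X,
      (inclC r).functor.comp V d = κ ∧ (inclB r).functor.comp V d = β := by
  obtain ⟨h, hκ, hβ⟩ : ∃ h : C ⊕ B' → X,
      (κ.obj = fun c => h (Sum.inl c)) ∧ β.obj = fun y => h (glue f y) := by
    refine ⟨Sum.elim κ.obj (fun b => β.obj (Sum.inr b)), rfl, funext fun y => ?_⟩
    rcases y with a | b
    · exact congrArg (fun F => F.obj a) comm
    · rfl
  obtain ⟨κ, rfl⟩ := FunctorOn.exists_functor_eq κ hκ
  obtain ⟨β, rfl⟩ := FunctorOn.exists_functor_eq β hβ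
  obtain ⟨d, hC, hB⟩ := (GluedFunctor.mk κ β comm).exists_desc r
  exact ⟨d.functor, hC, hB⟩

end UniversalProperty

end GluedModule

lemma isPushout_glued [MonoidalClosed V] (r : ∀ x, GluedModule.Representation j f x) :
    IsPushout (C := EnrichedCat.{w, v, w} V) (Z := EnrichedCat.of V A)
      (X := EnrichedCat.of V (A ⊕ B')) (Y := EnrichedCat.of V C)
      (P := EnrichedCat.of V (GluedModule.Glued r))
      j.functor f (GluedModule.inclB r).functor (GluedModule.inclC r).functor := by
  have exists_desc (s : PushoutCocone (C := EnrichedCat.{w, v, w} V) (X := EnrichedCat.of V A)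
      (Y := EnrichedCat.of V (A ⊕ B')) (Z := EnrichedCat.of V C) j.functor f) :=
    GluedModule.Glued.exists_desc r (X := s.pt) s.inr s.inl s.condition
  choose desc desc_inclC desc_inclB using exists_desc
  exact ⟨⟨GluedModule.inclB_inclC_comm r⟩, ⟨PushoutCocone.IsColimit.mk _ desc desc_inclB desc_inclC
    (fun s m hB hC => GluedModule.Glued.hom_ext (X := s.pt) (hC.trans (desc_inclC s).symm)
      (hB.trans (desc_inclB s).symm))⟩⟩

lemma isFullAndFaithfulInclusion_inclC [MonoidalClosed V] [HasColimitsOfSize.{w, w} V]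
    [∀ X : V, (tensorRight X).IsLeftAdjoint] (j : FunctorOn V (Sum.inl : A → A ⊕ B'))
    [∀ a a', IsIso (j.map a a')] (f : EnrichedFunctor V A C) :
    (GluedModule.inclC (GluedModule.representation j f)).functor.IsFullAndFaithfulInclusion where
  fullAndFaithful c c' := by
    have inclC_map : (GluedModule.inclC (GluedModule.representation j f)).map c c' =
        𝟙 (c ⟶[V] c') := RightAction.yonedaHom_representable_eId c c'
    exact (congrArg (fun φ => IsIso φ) inclC_map).mpr (IsIso.id _)
  injective_obj := Sum.inl_injective

end Gluing

/-! ### Reduction to a decomposed codomain -/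

section FullAndFaithful

lemma FunctorOn.exists_lift {A : Type*} {B : Type*} {X : Type*} [EnrichedCategory V A]
    [EnrichedCategory V B] [EnrichedCategory V X] {F : EnrichedFunctor V A B}
    (hF : F.FullAndFaithful) {o : X → A} (H : FunctorOn V (fun x => F.obj (o x))) :
    ∃ G : FunctorOn V o, G.functor.comp V F = H.functor := by
  have isIso_map (x y : X) : IsIso (F.map (o x) (o y)) := hF (o x) (o y)
  refine ⟨⟨fun x y => H.map x y ≫ inv (F.map (o x) (o y)), fun x => ?_, fun x y z => ?_⟩, ?_⟩
  · rw [← cancel_mono (F.map _ _)]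
    simp [H.map_id]
  · rw [← cancel_mono (F.map _ _)]
    simp [H.map_comp]
  · refine EnrichedFunctor.ext V (fun _ => rfl) (fun x y => (Category.comp_id _).trans ?_)
    exact (Category.assoc _ _ _).trans (by rw [IsIso.inv_hom_id, Category.comp_id])

variable {A B C : EnrichedCat.{w, v, w} V}

lemma fullAndFaithful_id (A : EnrichedCat.{w, v, w} V) :
    EnrichedFunctor.FullAndFaithful (𝟙 A) := fun _ _ => inferInstanceAs (IsIso (𝟙 _))

lemma fullAndFaithful_of_comp {F : A ⟶ B} {G : B ⟶ C} (hG : EnrichedFunctor.FullAndFaithful G)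
    (hFG : EnrichedFunctor.FullAndFaithful (F ≫ G)) : EnrichedFunctor.FullAndFaithful F :=
  fun x y => @IsIso.of_isIso_comp_right _ _ _ _ _ (EnrichedFunctor.map F x y) _ (hG _ _) (hFG x y)

lemma exists_section {F : A ⟶ B} (hF : EnrichedFunctor.FullAndFaithful F)
    (hobj : Function.Bijective (EnrichedFunctor.obj F)) :
    ∃ G : B ⟶ A, G ≫ F = 𝟙 B ∧ EnrichedFunctor.FullAndFaithful G ∧
      Function.Bijective (EnrichedFunctor.obj G) := by
  let σ := Equiv.ofBijective _ hobj
  obtain ⟨I, hI⟩ := FunctorOn.exists_functor_eq (EnrichedFunctor.id V B)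
    (o := fun b => EnrichedFunctor.obj F (σ.symm b))
    (funext fun b => (σ.apply_symm_apply b).symm)
  obtain ⟨G, hG⟩ := FunctorOn.exists_lift hF I
  let G' : B ⟶ A := G.functor
  have section_eq : G' ≫ F = 𝟙 B := hG.trans hI
  exact ⟨G', section_eq, fullAndFaithful_of_comp hF (section_eq ▸ fullAndFaithful_id B),
    σ.symm.bijective⟩

lemma isIso_of_fullAndFaithful_of_bijective {F : A ⟶ B} (hF : EnrichedFunctor.FullAndFaithful F)
    (hobj : Function.Bijective (EnrichedFunctor.obj F)) : IsIso F := by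
  obtain ⟨G, hGF, hG, hGobj⟩ := exists_section hF hobj
  obtain ⟨F', hF'G, -, -⟩ := exists_section hG hGobj
  have : F' = F := by rw [← Category.comp_id F', ← hGF, reassoc_of% hF'G]
  exact ⟨G, this ▸ hF'G, hGF⟩

lemma isIso_of_isIso_comp_of_isIso_comp {D : Type*} [Category D] {W X Y Z : D} (f : W ⟶ X)
    (g : X ⟶ Y) (h : Y ⟶ Z) [IsIso (f ≫ g)] [IsIso (g ≫ h)] : IsIso f := by
  have : Mono g := mono_of_mono g h
  have : IsSplitEpi g := ⟨⟨⟨inv (f ≫ g) ≫ f, by rw [Category.assoc, IsIso.inv_hom_id]⟩⟩⟩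
  have : IsIso g := isIso_of_mono_of_isSplitEpi g
  exact IsIso.of_isIso_comp_right f g

lemma fullAndFaithful_of_isIso (F : A ⟶ B) [IsIso F] : EnrichedFunctor.FullAndFaithful F := by
  have hFG : EnrichedFunctor.FullAndFaithful (F ≫ inv F) :=
    (IsIso.hom_inv_id F).symm ▸ fullAndFaithful_id A
  have hGF : EnrichedFunctor.FullAndFaithful (inv F ≫ F) :=
    (IsIso.inv_hom_id F).symm ▸ fullAndFaithful_id B
  exact fun x y => @isIso_of_isIso_comp_of_isIso_comp _ _ _ _ _ _ (EnrichedFunctor.map F x y)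
    (EnrichedFunctor.map (inv F) _ _) (EnrichedFunctor.map F _ _) (hFG x y) (hGF _ _)

lemma isFullAndFaithfulInclusion_of_isIso (F : A ⟶ B) [IsIso F] :
    EnrichedFunctor.IsFullAndFaithfulInclusion F where
  fullAndFaithful := fullAndFaithful_of_isIso F
  injective_obj := Function.LeftInverse.injective (g := EnrichedFunctor.obj (inv F))
    (fun x => congrArg (fun G : A ⟶ A => EnrichedFunctor.obj G x) (IsIso.hom_inv_id F))

lemma isFullAndFaithfulInclusion_comp {F : A ⟶ B} {G : B ⟶ C}
    (hF : EnrichedFunctor.IsFullAndFaithfulInclusion F)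
    (hG : EnrichedFunctor.IsFullAndFaithfulInclusion G) :
    EnrichedFunctor.IsFullAndFaithfulInclusion (F ≫ G) where
  fullAndFaithful x y := IsIso.comp_isIso' (hF.fullAndFaithful x y) (hG.fullAndFaithful _ _)
  injective_obj := hG.injective_obj.comp hF.injective_obj

end FullAndFaithful

section Complement

variable {A B : Type w} [EnrichedCategory V A] [EnrichedCategory V B]

/-- The objects of the codomain which are not in the image of a `V`-functor. -/
def Complement (i : EnrichedFunctor V A B) : Type w := ↥(Set.range i.obj)ᶜ

/-- The map `A ⊕ B' → B` which is a bijection if `i` is injective on objects and `B'` is the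
complement of its image. -/
def sumComplementObj (i : EnrichedFunctor V A B) : A ⊕ Complement i → B :=
  Sum.elim i.obj Subtype.val

lemma bijective_sumComplementObj {i : EnrichedFunctor V A B} (hi : Function.Injective i.obj) :
    Function.Bijective (sumComplementObj i) := by
  classical
  let e : A ⊕ Complement i ≃ B :=
    ((Equiv.ofInjective i.obj hi).sumCongr (Equiv.refl _)).trans
      (Equiv.Set.sumCompl (Set.range i.obj))
  have coe_e : ⇑e = sumComplementObj i := by
    funext y
    rcases y with a | b <;> rfl
  exact coe_e ▸ e.bijective

/-- The full `V`-subcategory structure, induced from `B`. -/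
instance (i : EnrichedFunctor V A B) : EnrichedCategory V (A ⊕ Complement i) where
  Hom x y := (sumComplementObj i x ⟶[V] sumComplementObj i y)
  id x := eId V (sumComplementObj i x)
  comp _ _ _ := eComp V _ _ _
  id_comp _ _ := e_id_comp V _ _
  comp_id _ _ := e_comp_id V _ _
  assoc _ _ _ _ := e_assoc V _ _ _ _

/-- A `V`-functor with codomain decomposed into its image and the complement, so that it is
`Sum.inl` on objects. -/
def toSumComplement (i : EnrichedFunctor V A B) : FunctorOn V (Sum.inl : A → A ⊕ Complement i) where
  map := i.map
  map_id := i.map_id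
  map_comp := i.map_comp

/-- The comparison of the decomposition with the original codomain. -/
def sumComplementFunctor (i : EnrichedFunctor V A B) : FunctorOn V (sumComplementObj i) where
  map x y := 𝟙 (sumComplementObj i x ⟶[V] sumComplementObj i y)
  map_id _ := Category.comp_id _
  map_comp x y z := by
    refine (Category.comp_id _).trans ?_
    exact ((congrArg (· ≫ _) (id_tensorHom_id _ _)).trans (Category.id_comp _)).symm

lemma toSumComplement_comp (i : EnrichedFunctor V A B) :
    (toSumComplement i).functor.comp V (sumComplementFunctor i).functor = i :=
  EnrichedFunctor.ext V (fun _ => rfl) (fun _ _ => (Category.comp_id _).trans (Category.comp_id _))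

lemma isIso_sumComplementFunctor {i : EnrichedFunctor V A B} (hi : Function.Injective i.obj) :
    IsIso (C := EnrichedCat.{w, v, w} V) (X := EnrichedCat.of V (A ⊕ Complement i))
      (Y := EnrichedCat.of V B) (sumComplementFunctor i).functor :=
  isIso_of_fullAndFaithful_of_bijective (fun _ _ => inferInstanceAs (IsIso (𝟙 _)))
    (bijective_sumComplementObj hi)

end Complement

lemma exists_isPushout [HasColimitsOfSize.{w, w} V] [MonoidalClosed V]
    [∀ X : V, (tensorRight X).IsLeftAdjoint] {A B C : EnrichedCat.{w, v, w} V} {i : A ⟶ B}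
    (hi : EnrichedFunctor.IsFullAndFaithfulInclusion i) (f : A ⟶ C) :
    ∃ (D : EnrichedCat.{w, v, w} V) (g : B ⟶ D) (i' : C ⟶ D),
      IsPushout i f g i' ∧ EnrichedFunctor.IsFullAndFaithfulInclusion i' := by
  let j := toSumComplement i
  have isIso_map (a a' : A) : IsIso (j.map a a') := hi.fullAndFaithful a a'
  let e : EnrichedCat.of V (A ⊕ Complement i) ⟶ B := (sumComplementFunctor i).functor
  have isIso_e : IsIso e := isIso_sumComplementFunctor hi.injective_obj
  let r := GluedModule.representation j f
  let g : EnrichedCat.of V (A ⊕ Complement i) ⟶ EnrichedCat.of V (GluedModule.Glued r) :=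
    (GluedModule.inclB r).functor
  let i' : C ⟶ EnrichedCat.of V (GluedModule.Glued r) := (GluedModule.inclC r).functor
  refine ⟨_, inv e ≫ g, i', ?_, isFullAndFaithfulInclusion_inclC j f⟩
  exact (isPushout_glued r).of_iso (Iso.refl _) (asIso e) (Iso.refl _) (Iso.refl _)
    ((toSumComplement_comp i).trans (Category.id_comp i).symm)
    ((Category.comp_id f).trans (Category.id_comp f).symm)
    ((Category.comp_id _).trans (IsIso.hom_inv_id_assoc e g).symm)
    ((Category.comp_id i').trans (Category.id_comp i').symm)

end EnrichedPushout

end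

theorem proposition3p1
    {V : Type v} [Category.{w} V] [MonoidalCategory V] [HasColimitsOfSize.{w, w} V]
    [MonoidalClosed V] [∀ X : V, (tensorRight X).IsLeftAdjoint]
    {A B C : EnrichedCat.{w, v, w} V} (i : A ⟶ B) (f : A ⟶ C)
    (hi : EnrichedFunctor.IsFullAndFaithfulInclusion i) :
    HasPushout i f ∧
      ∀ (D : EnrichedCat.{w, v, w} V) (g : B ⟶ D) (i' : C ⟶ D),
        IsPushout i f g i' → EnrichedFunctor.IsFullAndFaithfulInclusion i' := by
  obtain ⟨D₀, g₀, i₀, h₀, hi₀⟩ := EnrichedPushout.exists_isPushout hi f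
  refine ⟨h₀.hasPushout, fun D g i' h => ?_⟩
  rw [← h₀.inr_isoIsPushout_hom _ _ h]
  exact EnrichedPushout.isFullAndFaithfulInclusion_comp hi₀
    (EnrichedPushout.isFullAndFaithfulInclusion_of_isIso _)
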